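/- Let $G$ be a finite group. For an integer $n\ge 0$, an $n$-variable word is an element $w$ of the free group $\mathbf F_n$ on $x_1,\dots,x_n$; it induces the word map $w\colon G^n\to G$, sending $(g_1,\dots,g_n)$ to the element of $G$ obtained by substituting $g_i$ for $x_i$ in $w$, and the probability distribution $$\mu_{G,w}(g)=\frac{|\{(g_1,\dots,g_n)\in G^n : w(g_1,\dots,g_n)=g\}|}{|G|^n}\qquad (g\in G).$$ The distribution $\mu_{G,w}$ is called uniform if $\mu_{G,w}(g)=1/|G|$ for every $g\in G$. The following are equivalent: 1. $G$ is nilpotent. 2. For every $n$ and every $n$-variable word $w$ whose word map $w\colon G^n\to G$ is surjective, the distribution $\mu_{G,w}$ is uniform. 3. There is some $n>1$ such that for every $n$-variable word $w$ whose word map $w\colon G^n\to G$ is surjective, the distribution $\mu_{G,w}$ is uniform. -/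

import Mathlib

/-- The word map `G ^ n → G` induced by a word `w` in the free group on `x_1, …, x_n`:
substitute `g i` for the `i`-th variable and evaluate in `G`. -/
def wordMap {n : ℕ} (w : FreeGroup (Fin n)) (G : Type*) [Group G] (g : Fin n → G) : G :=
  FreeGroup.lift g w

/-- The distribution `μ_{G,w}(a) = |{g ∈ G ^ n : w(g) = a}| / |G| ^ n` on a finite group `G`. -/
noncomputable def wordDistribution {n : ℕ} (w : FreeGroup (Fin n)) (G : Type*) [Group G] (a : G) : ℚ :=
  (Nat.card {g : Fin n → G // wordMap w G g = a} : ℚ) / (Nat.card G : ℚ) ^ n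

/-- A distribution on a finite set `X` is uniform if every point has mass `1 / |X|`. -/
def IsUniformDistribution {X : Type*} (μ : X → ℚ) : Prop :=
  ∀ a : X, μ a = 1 / (Nat.card X : ℚ)

/-!
If `G` is not nilpotent, then it is not an Engel group (`IsEngelGroup.isNilpotent`), so that some map
`z ↦ ⁅z, y⁆` has a periodic point `x ≠ 1`. Let `N` be a period common to all periodic points of all
such maps. The word `x * [x, y, …, y]⁻¹` with `N` commutators has surjective word map because it
becomes `x` at `y = 1`. Its solutions of `w = 1` include the `|G|` pairs `(1, y)`, which is all that a
uniform distribution allows, but also the pairs `(x, y)` with `x` a nontrivial periodic point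
(`isEngelGroup_of_forall_surjective_isUniformDistribution`).

If `G` is nilpotent, the word map of `w` on a quotient of prime order `p` depends only on
the exponent sums of `w` modulo `p`. Each prime divisor of `|G|` is the order of a quotient, so a
surjective word map has exponent sums `k i` with some combination `∑ i, m i * k i` congruent to `1`
modulo `|G|` (`exists_zpow_weightedExponentSum_eq`). Replacing each argument `g i` by `g i * z ^ m i`
then multiplies the value of the word by `z`, for central `z`, and induction along the
central series shows that all fibres have the same size (`card_fiber_wordMap_eq`).
-/

open Function
open scoped commutatorElement

/-! ### Finite Engel groups are nilpotent -/

/-- Normalizers grow in a nilpotent subgroup `M`: some element of `M` outside `I < M`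
normalizes `I`. -/
theorem Subgroup.exists_mem_normalizer_of_lt_of_isNilpotent {G : Type*} [Group G]
    {I M : Subgroup G} [Group.IsNilpotent M] (h : I < M) :
    ∃ x ∈ M, x ∉ I ∧ x ∈ Subgroup.normalizer (I : Set G) := by
  have hlt : I.subgroupOf M < ⊤ := by
    rw [lt_top_iff_ne_top, Ne, Subgroup.subgroupOf_eq_top]
    exact h.not_ge
  obtain ⟨x, hxN, hxI⟩ := SetLike.exists_of_lt (Group.normalizerCondition_of_isNilpotent _ hlt)
  refine ⟨x, x.2, fun hx => hxI (Subgroup.mem_subgroupOf.2 hx), ?_⟩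
  rw [Subgroup.mem_normalizer_iff] at hxN ⊢
  intro g
  have key (g : G) (hg : g ∈ M) : g ∈ I ↔ (x : G) * g * (x : G)⁻¹ ∈ I := by
    simpa [Subgroup.mem_subgroupOf] using hxN ⟨g, hg⟩
  refine ⟨fun hg => (key g (h.le hg)).1 hg, fun hg => (key g ?_).2 hg⟩
  have := M.mul_mem (M.mul_mem (M.inv_mem x.2) (h.le hg)) x.2
  simpa [mul_assoc] using this

/-- A group in which every map `z ↦ ⁅z, y⁆` is nilpotent, in the sense that each of its orbits
reaches `1`. -/
def IsEngelGroup (G : Type*) [Group G] : Prop :=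
  ∀ x y : G, ∃ k : ℕ, (fun z => ⁅z, y⁆)^[k] x = 1

theorem MonoidHom.map_iterate_commutatorElement {G H : Type*} [Group G] [Group H] (f : G →* H)
    (x y : G) (k : ℕ) :
    f ((fun z => ⁅z, y⁆)^[k] x) = (fun z => ⁅z, f y⁆)^[k] (f x) :=
  (show Semiconj f (fun z => ⁅z, y⁆) (fun z => ⁅z, f y⁆) from
    fun z => map_commutatorElement f z y).iterate_right k x

theorem IsEngelGroup.of_injective {G H : Type*} [Group G] [Group H] (hG : IsEngelGroup G)
    (f : H →* G) (hf : Injective f) : IsEngelGroup H := fun x y => by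
  obtain ⟨k, hk⟩ := hG (f x) (f y)
  exact ⟨k, hf (by rw [f.map_iterate_commutatorElement, hk, map_one])⟩

theorem IsEngelGroup.of_surjective {G H : Type*} [Group G] [Group H] (hG : IsEngelGroup G)
    (f : G →* H) (hf : Surjective f) : IsEngelGroup H := fun x y => by
  obtain ⟨x, rfl⟩ := hf x
  obtain ⟨y, rfl⟩ := hf y
  obtain ⟨k, hk⟩ := hG x y
  exact ⟨k, by rw [← f.map_iterate_commutatorElement, hk, map_one]⟩

/-- In an Engel group each element of a proper subgroup `M` is carried back into `M` by conjugation
with some element outside `M`: iterate `z ↦ ⁅z, y⁆` from outside `M`, and take the last iterate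
that is not in `M`. -/
theorem IsEngelGroup.exists_notMem_conj_mem {G : Type*} [Group G] (hG : IsEngelGroup G)
    {M : Subgroup G} (hM : M ≠ ⊤) {y : G} (hy : y ∈ M) : ∃ z ∉ M, z * y * z⁻¹ ∈ M := by
  obtain ⟨x, hx⟩ : ∃ x, x ∉ M := by
    by_contra! h
    exact hM ((Subgroup.eq_top_iff' M).2 h)
  by_contra! h
  obtain ⟨k, hk⟩ := hG x y
  have key (k : ℕ) : (fun z => ⁅z, y⁆)^[k] x ∉ M := by
    induction k with
    | zero => exact hx
    | succ k ih =>
      rw [iterate_succ_apply', commutatorElement_def, M.mul_mem_cancel_right (M.inv_mem hy)]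
      exact h _ ih
  exact key k (hk ▸ M.one_mem)

theorem IsCoatom.normalizer_eq_of_not_normal {G : Type*} [Group G] {M : Subgroup G}
    (hM : IsCoatom M) (hn : ¬ M.Normal) : Subgroup.normalizer (M : Set G) = M :=
  (hM.le_iff.1 Subgroup.le_normalizer).resolve_left
    fun h => hn (Subgroup.normalizer_eq_top_iff.1 h)

/-- **Zorn's theorem**: a finite Engel group is nilpotent. In a minimal counterexample, a maximal
intersection of a non-normal maximal subgroup with another maximal subgroup is normal, hence
trivial, and this contradicts `IsEngelGroup.exists_notMem_conj_mem`. -/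
theorem IsEngelGroup.isNilpotent {G : Type*} [Group G] [Finite G] (hG : IsEngelGroup G) :
    Group.IsNilpotent G := by
  induction hc : Nat.card G using Nat.strong_induction_on generalizing G with
  | _ n ih =>
  subst hc
  have hsub (M : Subgroup G) (hM : M ≠ ⊤) : Group.IsNilpotent M :=
    ih _ (M.card_le_card_group.lt_of_ne fun h => hM (M.eq_top_of_card_eq h))
      (hG.of_injective M.subtype M.subtype_injective) rfl
  refine (Group.isNilpotent_of_finite_tfae.out 0 2).2 ?_
  by_contra! hbad
  obtain ⟨M₀, hM₀, hn₀⟩ := hbad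
  let S : Set (Subgroup G) :=
    {I | ∃ M L : Subgroup G, IsCoatom M ∧ ¬ M.Normal ∧ IsCoatom L ∧ L ≠ M ∧ I = M ⊓ L}
  -- A maximal member `I` of `S` is normal, as its normalizer is not contained in `M`.
  -- If `I` were nontrivial, `G ⧸ I` would be nilpotent and `M` normal.
  have hmax (I : Subgroup G) (hI : Maximal (· ∈ S) I) : I = ⊥ := by
    obtain ⟨M, L, hM, hMn, hL, hLM, rfl⟩ := hI.prop
    have hltM : M ⊓ L < M := inf_lt_left.2 fun h => hLM ((hM.le_iff.1 h).resolve_left hL.1)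
    have hltL : M ⊓ L < L := inf_lt_right.2 fun h => hLM ((hL.le_iff.1 h).resolve_left hM.1).symm
    have := hsub M hM.1
    have := hsub L hL.1
    obtain ⟨a, haM, haI, haN⟩ := Subgroup.exists_mem_normalizer_of_lt_of_isNilpotent hltM
    obtain ⟨b, hbL, hbI, hbN⟩ := Subgroup.exists_mem_normalizer_of_lt_of_isNilpotent hltL
    have hnormal : (M ⊓ L).Normal := by
      by_contra hnn
      obtain h | ⟨K, hK, hNK⟩ :=
        eq_top_or_exists_le_coatom (Subgroup.normalizer ((M ⊓ L : Subgroup G) : Set G))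
      · exact hnn (Subgroup.normalizer_eq_top_iff.1 h)
      have hIK : M ⊓ L ≤ K := Subgroup.le_normalizer.trans hNK
      by_cases hKM : K = M
      · subst hKM
        exact hbI ⟨hNK hbN, hbL⟩
      · have := hI.le_of_ge (y := M ⊓ K) ⟨M, K, hM, hMn, hK, hKM, rfl⟩ (le_inf inf_le_left hIK)
        exact haI (this ⟨haM, hNK haN⟩)
    by_contra hbot
    have hnil : Group.IsNilpotent (G ⧸ (M ⊓ L)) := by
      refine ih _ ?_ (hG.of_surjective (QuotientGroup.mk' _) (QuotientGroup.mk'_surjective _)) rfl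
      rw [(M ⊓ L).card_eq_card_quotient_mul_card_subgroup]
      exact lt_mul_of_one_lt_right Nat.card_pos ((M ⊓ L).one_lt_card_iff_ne_bot.2 hbot)
    let π := QuotientGroup.mk' (M ⊓ L)
    have hcm : (M.map π).comap π = M := by
      rw [Subgroup.comap_map_eq, QuotientGroup.ker_mk', sup_eq_left]
      exact inf_le_left
    have hco : IsCoatom (M.map π) := by
      refine ⟨fun h => hM.1 (by rw [← hcm, h, Subgroup.comap_top]), fun K hK => ?_⟩
      have hlt : M < K.comap π := by
        have := (Subgroup.comap_lt_comap_of_surjective (QuotientGroup.mk'_surjective _)).2 hK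
        rwa [hcm] at this
      rw [← Subgroup.map_comap_eq_self_of_surjective (QuotientGroup.mk'_surjective _) K, hM.2 _ hlt,
        Subgroup.map_top_of_surjective _ (QuotientGroup.mk'_surjective _)]
    have hall : ∀ K : Subgroup (G ⧸ (M ⊓ L)), IsCoatom K → K.Normal :=
      (Group.isNilpotent_of_finite_tfae.out 0 2).1 hnil
    exact hMn (hcm ▸ (hall _ hco).comap π)
  refine hn₀ ?_
  suffices M₀ = ⊥ from this ▸ Subgroup.normal_bot
  rw [eq_bot_iff]
  intro y hy
  obtain ⟨z, hz, hzy⟩ := hG.exists_notMem_conj_mem hM₀.1 hy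
  let L := M₀.comap (MulAut.conj z).toMonoidHom
  have hLc : IsCoatom L := (Subgroup.isCoatom_comap (MulAut.conj z)).2 hM₀
  have hLM : L ≠ M₀ := fun h => hz <| by
    rw [← hM₀.normalizer_eq_of_not_normal hn₀, Subgroup.mem_normalizer_iff]
    exact fun g => (SetLike.ext_iff.1 h g).symm
  obtain ⟨I, hle, hI⟩ := Set.Finite.exists_le_maximal (Set.toFinite S)
    (show M₀ ⊓ L ∈ S from ⟨M₀, L, hM₀, hn₀, hLc, hLM, rfl⟩)
  exact hmax I hI ▸ hle ⟨hy, hzy⟩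

/-! ### Word maps and homomorphisms -/

theorem map_wordMap {n : ℕ} (w : FreeGroup (Fin n)) {G H : Type*} [Group G] [Group H] (f : G →* H)
    (g : Fin n → G) : f (wordMap w G g) = wordMap w H (fun i => f (g i)) := by
  have : f.comp (FreeGroup.lift g) = FreeGroup.lift fun i => f (g i) := by
    ext i
    simp
  exact DFunLike.congr_fun this w

theorem wordMap_surjective_of_surjective {n : ℕ} {w : FreeGroup (Fin n)} {G H : Type*} [Group G]
    [Group H] (f : G →* H) (hf : Surjective f) (hw : Surjective (wordMap w G)) :
    Surjective (wordMap w H) := fun a => by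
  obtain ⟨a, rfl⟩ := hf a
  obtain ⟨g, rfl⟩ := hw a
  exact ⟨_, (map_wordMap w f g).symm⟩

/-! ### A surjective word map that is not uniform -/

theorem ncard_fiber_one_eq {n : ℕ} {w v : FreeGroup (Fin n)} {G : Type*} [Group G] [Finite G]
    (hw : IsUniformDistribution (wordDistribution w G))
    (hv : IsUniformDistribution (wordDistribution v G)) :
    {g | wordMap w G g = 1}.ncard = {g | wordMap v G g = 1}.ncard := by
  have h := (hw 1).trans (hv 1).symm
  have hG : (Nat.card G : ℚ) ^ n ≠ 0 := pow_ne_zero _ (Nat.cast_ne_zero.2 Nat.card_pos.ne')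
  unfold wordDistribution at h
  exact_mod_cast (div_left_inj' hG).1 h

/-- If every surjective word map in `n > 1` variables is uniform then `G` is an Engel group. For
`N` a common period of the periodic points of all the maps `z ↦ ⁅z, y⁆`, the word
`x * [x, y, …, y]⁻¹` with `N` commutators has surjective word map, as `y = 1` shows, and it takes the
value `1` at `(x, y)` exactly when `x` is a periodic point of `z ↦ ⁅z, y⁆`. Uniformity leaves no
room for periodic points other than `x = 1`. -/
theorem isEngelGroup_of_forall_surjective_isUniformDistribution {G : Type*} [Group G] [Finite G]
    {n : ℕ} (hn : 1 < n)
    (h : ∀ w : FreeGroup (Fin n), Surjective (wordMap w G) →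
      IsUniformDistribution (wordDistribution w G)) : IsEngelGroup G := by
  have := Fintype.ofFinite G
  let i : Fin n := ⟨0, by omega⟩
  let j : Fin n := ⟨1, hn⟩
  have hij : i ≠ j := by simp [i, j]
  let N := (Fintype.card G).factorial
  let w : FreeGroup (Fin n) :=
    .of i * ((fun z => ⁅z, .of j⁆)^[N] (.of i))⁻¹
  have hval (g : Fin n → G) : wordMap w G g = g i * ((fun z => ⁅z, g j⁆)^[N] (g i))⁻¹ := by
    simp only [wordMap, w, map_mul, map_inv, MonoidHom.map_iterate_commutatorElement,
      FreeGroup.lift_apply_of]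
  have hvar (g : Fin n → G) : wordMap (.of i) G g = g i := by simp [wordMap]
  have hwsurj : Surjective (wordMap w G) := fun a => by
    refine ⟨update 1 i a, ?_⟩
    obtain ⟨m, hm⟩ : ∃ m, N = m + 1 := Nat.exists_eq_succ_of_ne_zero (Nat.factorial_ne_zero _)
    have hj : update (1 : Fin n → G) i a j = 1 := by simp [update_of_ne hij.symm]
    rw [hval, hj, hm, iterate_succ_apply']
    simp
  have hcard := ncard_fiber_one_eq (h w hwsurj)
    (h (.of i) fun a => ⟨fun _ => a, hvar _⟩)
  have hsub : {g : Fin n → G | wordMap (.of i) G g = 1} ⊆ {g | wordMap w G g = 1} := by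
    intro g hg
    rw [Set.mem_ofPred_eq, hvar] at hg
    have hfix : ⁅(1 : G), g j⁆ = 1 := commutatorElement_one_left _
    rw [Set.mem_ofPred_eq, hval, hg, iterate_fixed (f := fun z => ⁅z, g j⁆) hfix]
    simp
  have heq := Set.eq_of_subset_of_ncard_le hsub hcard.le
  have hper (x y : G) (hx : x ∈ periodicPts fun z => ⁅z, y⁆) : x = 1 := by
    have hg : update (fun _ => x) j y ∈ {g : Fin n → G | wordMap w G g = 1} := by
      have hN : (fun z => ⁅z, y⁆)^[N] x = x := isPeriodicPt_factorial_card_of_mem_periodicPts hx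
      rw [Set.mem_ofPred_eq, hval, update_self, update_of_ne hij, hN, mul_inv_cancel]
    rw [← heq, Set.mem_ofPred_eq, hvar, update_of_ne hij] at hg
    exact hg
  intro x y
  obtain ⟨a, b, hab, hk⟩ := Finite.exists_ne_map_eq_of_infinite fun k => (fun z => ⁅z, y⁆)^[k] x
  wlog hlt : a < b generalizing a b
  · exact this b a hab.symm hk.symm (by omega)
  refine ⟨a, hper _ y (mk_mem_periodicPts (Nat.sub_pos_of_lt hlt) ?_)⟩
  rw [IsPeriodicPt, IsFixedPt, ← iterate_add_apply, Nat.sub_add_cancel hlt.le]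
  exact hk.symm

/-! ### Exponent sums -/

/-- The homomorphism from the free group to `ℤ` sending `x_i` to `m i`. Its value at `w` is
`∑ i, m i * k i` for `k i` the exponent sum of `x_i` in `w`. -/
def weightedExponentSum {n : ℕ} (m : Fin n → ℤ) : FreeGroup (Fin n) →* Multiplicative ℤ :=
  FreeGroup.lift fun i => .ofAdd (m i)

theorem weightedExponentSum_add {n : ℕ} (m m' : Fin n → ℤ) :
    weightedExponentSum (m + m') = weightedExponentSum m * weightedExponentSum m' := by
  ext i
  simp [weightedExponentSum]

/-- Multiplying the arguments of a word map by powers of a central element `z` multiplies its value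
by a power of `z`. -/
theorem wordMap_mul_zpow {n : ℕ} (w : FreeGroup (Fin n)) {G : Type*} [Group G] {z : G}
    (hz : z ∈ Subgroup.center G) (m : Fin n → ℤ) (g : Fin n → G) :
    wordMap w G (fun i => g i * z ^ m i) =
      wordMap w G g * z ^ (weightedExponentSum m w).toAdd := by
  have hc (k : ℤ) (a : G) : Commute (z ^ k) a :=
    Commute.zpow_left (Subgroup.mem_center_iff.1 hz a).symm k
  unfold wordMap
  induction w using FreeGroup.induction_on with
  | C1 => simp
  | of i => simp [weightedExponentSum]
  | inv_of i _ => simp [weightedExponentSum, (hc _ _).inv_left.eq]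
  | mul v w hv hw =>
    rw [map_mul, hv, hw, map_mul, map_mul, toAdd_mul, zpow_add, mul_assoc, mul_assoc,
      ← mul_assoc (z ^ _) (FreeGroup.lift g w), (hc _ _).eq, mul_assoc]

/-- A finite nilpotent group has a normal subgroup of every prime index that divides its order:
the group projects onto its Sylow subgroups. -/
theorem Group.IsNilpotent.exists_normal_index_eq {G : Type*} [Group G] [Finite G]
    [Group.IsNilpotent G] {p : ℕ} [hp : Fact p.Prime] (hpG : p ∣ Nat.card G) :
    ∃ N : Subgroup G, N.Normal ∧ N.index = p := by
  obtain ⟨e⟩ : Nonempty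
      ((∀ p : (Nat.card G).primeFactors, ∀ P : Sylow p G, (P : Subgroup G)) ≃* G) :=
    (Group.isNilpotent_of_finite_tfae.out 0 4).1 ‹_›
  obtain ⟨P⟩ : Nonempty (Sylow p G) := inferInstance
  let q : (Nat.card G).primeFactors :=
    ⟨p, Nat.mem_primeFactors.2 ⟨hp.out, hpG, Nat.card_pos.ne'⟩⟩
  let f : G →* P :=
    ((Pi.evalMonoidHom (fun P : Sylow q G => (P : Subgroup G)) P).comp
      (Pi.evalMonoidHom (fun q : (Nat.card G).primeFactors =>
        ∀ P : Sylow q G, (P : Subgroup G)) q)).comp e.symm.toMonoidHom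
  have hf : Surjective f :=
    ((surjective_eval (β := fun P : Sylow q G => (P : Subgroup G)) P).comp
      (surjective_eval (β := fun q : (Nat.card G).primeFactors =>
        ∀ P : Sylow q G, (P : Subgroup G)) q)).comp e.symm.surjective
  obtain ⟨k, hk⟩ := IsPGroup.iff_card.1 P.isPGroup'
  obtain ⟨k, rfl⟩ : ∃ l, k = l + 1 := Nat.exists_eq_succ_of_ne_zero <| by
    rintro rfl
    exact P.ne_bot_of_dvd_card hpG (Subgroup.card_eq_one.1 (by rw [hk, pow_zero]))
  obtain ⟨H, hH⟩ := Sylow.exists_subgroup_card_pow_prime (G := P) p (n := k)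
    (hk ▸ pow_dvd_pow p k.le_succ)
  have hidx : H.index = p := by
    have := H.card_mul_index
    rw [hH, hk, pow_succ] at this
    exact Nat.eq_of_mul_eq_mul_left (pow_pos hp.out.pos k) this
  have hHn : H.Normal := Subgroup.normal_of_index_eq_minFac_card (by
    rw [hidx, hk, Nat.Prime.pow_minFac hp.out k.succ_ne_zero])
  exact ⟨H.comap f, hHn.comap f, by rw [H.index_comap_of_surjective hf, hidx]⟩

/-- A word with surjective word map on a group of prime order `p` has an exponent sum prime to `p`.
Otherwise all its values, at powers of a generator, would be trivial. -/
theorem not_forall_dvd_weightedExponentSum {n : ℕ} {w : FreeGroup (Fin n)} {C : Type*} [Group C]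
    {p : ℕ} [hp : Fact p.Prime] (hC : Nat.card C = p) (hw : Surjective (wordMap w C)) :
    ¬ ∀ m, (p : ℤ) ∣ (weightedExponentSum m w).toAdd := by
  intro h
  have := isCyclic_of_prime_card hC
  obtain ⟨c, hc⟩ := IsCyclic.exists_zpow_surjective (G := C)
  have : Finite C := Nat.finite_of_card_ne_zero (hC ▸ hp.out.ne_zero)
  have : Nontrivial C := Finite.one_lt_card_iff_nontrivial.1 (hC ▸ hp.out.one_lt)
  obtain ⟨a, ha⟩ := exists_ne (1 : C)
  obtain ⟨g, rfl⟩ := hw a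
  choose m hm using fun i => hc (g i)
  have hcc : c ∈ Subgroup.center C := Subgroup.mem_center_iff.2 fun x => by
    obtain ⟨k, rfl⟩ := hc x
    exact (Commute.refl c).zpow_left k
  obtain ⟨k, hk⟩ := h m
  have hval := wordMap_mul_zpow w hcc m (fun _ => 1)
  have h1 : wordMap w C (fun _ => 1) = 1 := by
    simpa using (map_wordMap w (1 : C →* C) g).symm
  rw [h1, hk, zpow_mul, zpow_natCast, ← hC, pow_card_eq_one', one_zpow, mul_one] at hval
  exact ha (by simpa [hm] using hval)

/-- If a word map on a finite nilpotent group is surjective, the exponent sums of the word have no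
common factor with the order of the group, and so they combine to `1` modulo this order. -/
theorem exists_zpow_weightedExponentSum_eq {n : ℕ} {w : FreeGroup (Fin n)} {G : Type*} [Group G]
    [Finite G] [Group.IsNilpotent G] (hw : Surjective (wordMap w G)) :
    ∃ m, ∀ g : G, g ^ (weightedExponentSum m w).toAdd = g := by
  let E : (Fin n → ℤ) →+ ℤ :=
    AddMonoidHom.mk' (fun m => (weightedExponentSum m w).toAdd) fun m m' => by
      simp [weightedExponentSum_add]
  obtain ⟨d, hd⟩ := Int.subgroup_cyclic E.range
  have hcop : IsCoprime d (Nat.card G : ℤ) := by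
    rw [Int.isCoprime_iff_gcd_eq_one, Int.gcd_eq_natAbs, Int.natAbs_natCast]
    refine Nat.Coprime.gcd_eq_one (Nat.Coprime.symm ?_)
    refine Nat.coprime_of_dvd fun p hp hpG hpd => ?_
    have := Fact.mk hp
    obtain ⟨N, _, hN⟩ := Group.IsNilpotent.exists_normal_index_eq hpG
    refine not_forall_dvd_weightedExponentSum (C := G ⧸ N) hN
      (wordMap_surjective_of_surjective (QuotientGroup.mk' N) (QuotientGroup.mk'_surjective N) hw) ?_
    intro m
    have hm : E m ∈ AddSubgroup.closure {d} := hd ▸ ⟨m, rfl⟩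
    obtain ⟨k, hk⟩ := AddSubgroup.mem_closure_singleton.1 hm
    exact (Int.natCast_dvd.2 hpd).trans ⟨k, by rw [mul_comm, ← smul_eq_mul, hk]; rfl⟩
  obtain ⟨u, v, huv⟩ := hcop
  obtain ⟨m, hm⟩ : u * d ∈ E.range := hd ▸ AddSubgroup.mem_closure_singleton.2 ⟨u, by simp⟩
  refine ⟨m, fun g => ?_⟩
  have hm' : (weightedExponentSum m w).toAdd = 1 - v * Nat.card G := by
    rw [← huv, add_sub_cancel_right]
    exact hm
  rw [hm', zpow_sub, mul_comm v, zpow_mul, zpow_natCast, pow_card_eq_one', one_zpow, zpow_one,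
    inv_one, mul_one]

/-! ### Fibres of word maps on nilpotent groups -/

/-- If raising to the power `∑ i, m i * k i`, for `k i` the exponent sums of `w`, is the identity
map of a finite nilpotent group, then all the fibres of the word map are equally large: they are so
modulo the centre `Z`, and over each coset of `Z` multiplication by the powers `z ^ m i` of `z ∈ Z`
permutes the fibres transitively. -/
theorem card_fiber_wordMap_eq {n : ℕ} (w : FreeGroup (Fin n)) (m : Fin n → ℤ) (G : Type*) [Group G]
    [Group.IsNilpotent G] [Finite G] (hm : ∀ g : G, g ^ (weightedExponentSum m w).toAdd = g)
    (a b : G) : Nat.card {g // wordMap w G g = a} = Nat.card {g // wordMap w G g = b} := by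
  refine Group.nilpotent_center_quotient_ind (P := fun G _ _ => Finite G →
    (∀ g : G, g ^ (weightedExponentSum m w).toAdd = g) →
    ∀ a b : G, Nat.card {g // wordMap w G g = a} = Nat.card {g // wordMap w G g = b}) G
    (fun G _ _ _ _ a b => by rw [Subsingleton.elim a b]) ?_ ‹_› hm a b
  clear! G
  intro G _ _ ih _ hm a b
  let Z := Subgroup.center G
  let π : G →* G ⧸ Z := QuotientGroup.mk' Z
  have ih' := ih inferInstance fun g => by
    obtain ⟨g, rfl⟩ := QuotientGroup.mk'_surjective _ g
    rw [← map_zpow, hm]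
  -- A point of `(G ⧸ Z) ^ n` has `|Z| ^ n` lifts to `G ^ n`.
  have hpre (ā : G ⧸ Z) : Nat.card {g // π (wordMap w G g) = ā} =
      Nat.card {x // wordMap w (G ⧸ Z) x = ā} * Nat.card (Fin n → Z) := by
    rw [← Nat.card_prod]
    let e : (Fin n → G) ≃ (Fin n → G ⧸ Z) × (Fin n → Z) :=
      (Equiv.piCongrRight fun _ => Subgroup.groupEquivQuotientProdSubgroup).trans
        (Equiv.arrowProdEquivProdArrow _ _ _)
    have he (g : Fin n → G) : (e g).1 = fun i => π (g i) := rfl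
    refine Nat.card_congr <| Equiv.trans (Equiv.subtypeEquiv e fun g => ?_)
      (Equiv.prodSubtypeFstEquivSubtypeProd (p := fun x => wordMap w (G ⧸ Z) x = ā))
    rw [he, map_wordMap]
  -- Over each value in the coset of `a` lies a translate of the fibre over `a`.
  have hcoset (a : G) : Nat.card {g // π (wordMap w G g) = π a} =
      Nat.card Z * Nat.card {g // wordMap w G g = a} := by
    rw [← Nat.card_prod]
    have hmul (z : Z) (g : Fin n → G) :
        wordMap w G (fun i => g i * (z : G) ^ m i) = wordMap w G g * z := by
      rw [wordMap_mul_zpow w z.2, hm]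
    exact Nat.card_congr
      { toFun g :=
          let z : Z := ⟨a⁻¹ * wordMap w G g, QuotientGroup.eq.1 g.2.symm⟩
          (z, ⟨fun i => g.1 i * ((z⁻¹ : Z) : G) ^ m i, by rw [hmul]; simp [z]⟩)
        invFun x := ⟨fun i => x.2.1 i * (x.1 : G) ^ m i, by
          rw [hmul, x.2.2, map_mul, mul_eq_left]
          exact (QuotientGroup.eq_one_iff _).2 x.1.2⟩
        left_inv g := by
          ext i
          simp only [Subgroup.coe_inv, inv_zpow, inv_mul_cancel_right]
        right_inv x := by
          have hz : a⁻¹ * wordMap w G (fun i => x.2.1 i * (x.1 : G) ^ m i) = x.1 := by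
            rw [hmul, x.2.2, inv_mul_cancel_left]
          ext <;> simp [hz] }
  have := (hcoset a).symm.trans (hpre _)
  rw [ih' _ (π b), ← hpre, hcoset] at this
  exact Nat.eq_of_mul_eq_mul_left Nat.card_pos this

theorem isUniformDistribution_of_card_fiber_eq {n : ℕ} {w : FreeGroup (Fin n)} {G : Type*} [Group G]
    [Finite G]
    (h : ∀ a b : G, Nat.card {g // wordMap w G g = a} = Nat.card {g // wordMap w G g = b}) :
    IsUniformDistribution (wordDistribution w G) := by
  intro a
  have hsum : Nat.card G ^ n = Nat.card G * Nat.card {g // wordMap w G g = a} := by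
    have := Fintype.ofFinite G
    calc Nat.card G ^ n = Nat.card (Fin n → G) := by simp
      _ = _ := by
        rw [← Nat.card_congr (Equiv.sigmaFiberEquiv (wordMap w G)), Nat.card_sigma]
        simp [h _ a]
  have hG : (Nat.card G : ℚ) ≠ 0 := Nat.cast_ne_zero.2 Nat.card_pos.ne'
  have hsum' : (Nat.card G : ℚ) ^ n = Nat.card G * Nat.card {g // wordMap w G g = a} := by
    exact_mod_cast hsum
  unfold wordDistribution
  rw [div_eq_div_iff (pow_ne_zero _ hG) hG, hsum']
  ring

theorem mainTheorem1 (G : Type*) [Group G] [Finite G] :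
    List.TFAE
      [ Group.IsNilpotent G,
        ∀ (n : ℕ) (w : FreeGroup (Fin n)), Function.Surjective (wordMap w G) →
          IsUniformDistribution (wordDistribution w G),
        ∃ n : ℕ, 1 < n ∧ ∀ w : FreeGroup (Fin n), Function.Surjective (wordMap w G) →
          IsUniformDistribution (wordDistribution w G) ] := by
  tfae_have 1 → 2 := fun _ n w hw => by
    obtain ⟨m, hm⟩ := exists_zpow_weightedExponentSum_eq hw
    exact isUniformDistribution_of_card_fiber_eq (card_fiber_wordMap_eq w m G hm)
  tfae_have 2 → 3 := fun h => ⟨2, one_lt_two, h 2⟩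
  tfae_have 3 → 1 := fun ⟨_, hn, h⟩ =>
    (isEngelGroup_of_forall_surjective_isUniformDistribution hn h).isNilpotent
  tfae_finish
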